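/- Let $n\in\{1,2,4,8\}$. A smooth map between Riemannian manifolds is a harmonic morphism if it pulls back every real-valued harmonic function on an open subset of the target to a harmonic function on the preimage of that subset; a quadratic harmonic morphism $\mathbb{R}^m\to\mathbb{R}^k$ is a harmonic morphism all of whose components are homogeneous polynomials of degree $2$ (the zero polynomial being allowed). Two quadratic harmonic morphisms $\varphi,\tilde\varphi:\mathbb{R}^m\to\mathbb{R}^k$ are bi-equivalent if $\varphi=B^{-1}\circ\tilde\varphi\circ A$ for some $A\in O(\mathbb{R}^m)$, $B\in O(\mathbb{R}^k)$. Let $p_n:\mathbb{R}^n\times\mathbb{R}^n\to\mathbb{R}^n$ be the standard multiplication of the real, complex, quaternionic or Cayley numbers for $n=1,2,4,8$ respectively, and let $$H:\mathbb{R}^{2n}=\mathbb{R}^n\times\mathbb{R}^n\to\mathbb{R}^{n+1},\qquad H(x,y)=\bigl(\|x\|^2-\|y\|^2,\;2p_n(x,y)\bigr)$$ be its Hopf construction map. Then for every quadratic harmonic morphism $\varphi:\mathbb{R}^{2n}\to\mathbb{R}^{n+1}$ there is a constant $\lambda\ge 0$ such that $\varphi$ is bi-equivalent to $\lambda H$.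 If moreover $\varphi\not\equiv 0$, then $\lambda>0$, and $\varphi$ maps the unit sphere $S^{2n-1}\subset\mathbb{R}^{2n}$ into the sphere $S^n(\lambda)\subset\mathbb{R}^{n+1}$ of radius $\lambda$ centred at $0$, and its restriction $S^{2n-1}\to S^n(\lambda)$ is a harmonic morphism, both spheres carrying the metrics induced from Euclidean space. -/

import Mathlib

open scoped ContDiff Quaternion

noncomputable section

/-! ### Harmonic morphisms between Euclidean spaces -/

/-- A smooth map between Euclidean spaces is a harmonic morphism if it pulls back every harmonic
function on an open subset of the target to a harmonic function on the preimage of that subset. -/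
def IsHarmonicMorphism {m n : ℕ}
    (φ : EuclideanSpace ℝ (Fin m) → EuclideanSpace ℝ (Fin n)) : Prop :=
  ContDiff ℝ ∞ φ ∧
    ∀ (U : Set (EuclideanSpace ℝ (Fin n))) (f : EuclideanSpace ℝ (Fin n) → ℝ),
      IsOpen U → InnerProductSpace.HarmonicOnNhd f U →
        InnerProductSpace.HarmonicOnNhd (f ∘ φ) (φ ⁻¹' U)

/-- The set `H₂(m, n)` of quadratic harmonic morphisms `ℝᵐ → ℝⁿ`: harmonic morphisms all of whose
components are homogeneous polynomials of degree 2 (the zero polynomial being allowed). -/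
def QuadraticHarmonicMorphisms (m n : ℕ) :
    Set (EuclideanSpace ℝ (Fin m) → EuclideanSpace ℝ (Fin n)) :=
  {φ | IsHarmonicMorphism φ ∧
    ∀ α : Fin n, ∃ p : MvPolynomial (Fin m) ℝ, p.IsHomogeneous 2 ∧
      ∀ x, φ x α = MvPolynomial.eval (fun i => x i) p}

/-- Bi-equivalence of two quadratic harmonic morphisms `φ, ψ ∈ H₂(m, n)`: there are
`G ∈ O(ℝᵐ)` and `H ∈ O(ℝⁿ)` with `φ = H⁻¹ ∘ ψ ∘ G`. -/
def BiEquivalent {m n : ℕ}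
    (φ ψ : EuclideanSpace ℝ (Fin m) → EuclideanSpace ℝ (Fin n)) : Prop :=
  φ ∈ QuadraticHarmonicMorphisms m n ∧ ψ ∈ QuadraticHarmonicMorphisms m n ∧
    ∃ (G : EuclideanSpace ℝ (Fin m) ≃ₗᵢ[ℝ] EuclideanSpace ℝ (Fin m))
      (H : EuclideanSpace ℝ (Fin n) ≃ₗᵢ[ℝ] EuclideanSpace ℝ (Fin n)),
      φ = H.symm ∘ ψ ∘ G

/-! ### Harmonic morphisms between Euclidean spheres -/

/-- The extension of a map on the sphere of radius `r` about `0` that is constant on open rays: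
`x ↦ f (r x / ‖x‖)` for `x ≠ 0` (when `r ≥ 0`). The value `0` elsewhere is irrelevant. -/
def radialExtension {E V : Type*} [NormedAddCommGroup E] [NormedSpace ℝ E] [Zero V] (r : ℝ)
    (f : Metric.sphere (0 : E) r → V) (x : E) : V :=
  open Classical in
  if h : (r / ‖x‖) • x ∈ Metric.sphere (0 : E) r then f ⟨(r / ‖x‖) • x, h⟩ else 0

/-- The open cone `{t y | t > 0, y ∈ U}` over a subset `U` of a sphere. -/
def coneOver {E : Type*} [NormedAddCommGroup E] [NormedSpace ℝ E] {r : ℝ}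
    (U : Set (Metric.sphere (0 : E) r)) : Set E :=
  {x | ∃ t : ℝ, 0 < t ∧ ∃ y ∈ U, x = t • (y : E)}

/-- Harmonicity of a function on an open subset `U` of the round sphere of radius `r > 0` in
Euclidean space. The Laplace-Beltrami operator of the sphere is the restriction to the sphere of the
Euclidean Laplacian of the extension that is constant on rays. That extension `F` satisfies
`ΔF (t y) = t⁻² ΔF (y)`, so `f` is twice continuously differentiable with vanishing
Laplace-Beltrami operator on `U` if and only if `F` is harmonic on the cone over `U`. -/
def HarmonicOnSphere {k : ℕ} {r : ℝ}
    (f : Metric.sphere (0 : EuclideanSpace ℝ (Fin k)) r → ℝ)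
    (U : Set (Metric.sphere (0 : EuclideanSpace ℝ (Fin k)) r)) : Prop :=
  InnerProductSpace.HarmonicOnNhd (radialExtension r f) (coneOver U)

/-- Harmonic morphisms between round spheres of radii `r, s > 0` (with the metrics induced from
Euclidean space): smooth maps that pull back harmonic functions on open subsets of the target to
harmonic functions on the preimages. Smoothness is that of the extension, constant on rays, of the
map viewed as a map into the Euclidean space around the target. -/
def IsSphereHarmonicMorphism {k l : ℕ} {r s : ℝ}
    (ψ : Metric.sphere (0 : EuclideanSpace ℝ (Fin k)) r →
      Metric.sphere (0 : EuclideanSpace ℝ (Fin l)) s) : Prop :=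
  ContDiffOn ℝ ∞ (radialExtension r (fun x => (ψ x : EuclideanSpace ℝ (Fin l)))) {0}ᶜ ∧
    ∀ (U : Set (Metric.sphere (0 : EuclideanSpace ℝ (Fin l)) s))
      (f : Metric.sphere (0 : EuclideanSpace ℝ (Fin l)) s → ℝ),
      IsOpen U → HarmonicOnSphere f U → HarmonicOnSphere (f ∘ ψ) (ψ ⁻¹' U)

/-! ### The standard multiplications and the Hopf construction -/

/-- The quaternion `a + b i + c j + d k`. -/
def quaternionOf (a b c d : ℝ) : ℍ[ℝ] := ⟨a, b, c, d⟩

/-- The multiplication of the Cayley numbers (octonions), regarded as pairs of quaternions. -/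
def cayleyMul (p q : ℍ[ℝ] × ℍ[ℝ]) : ℍ[ℝ] × ℍ[ℝ] :=
  (p.1 * q.1 - star q.2 * p.2, q.2 * p.1 + p.2 * star q.1)

/-- The standard multiplication of real, complex, quaternionic and Cayley numbers on `ℝⁿ`,
`n = 1, 2, 4, 8`, in the standard real coordinates (and `0` for the irrelevant other values
of `n`). -/
def standardMul : (n : ℕ) → (Fin n → ℝ) → (Fin n → ℝ) → Fin n → ℝ
  | 1, x, y => ![x 0 * y 0]
  | 2, x, y =>
      let z : ℂ := (⟨x 0, x 1⟩ : ℂ) * ⟨y 0, y 1⟩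
      ![z.re, z.im]
  | 4, x, y =>
      let z : ℍ[ℝ] := quaternionOf (x 0) (x 1) (x 2) (x 3) * quaternionOf (y 0) (y 1) (y 2) (y 3)
      ![z.re, z.imI, z.imJ, z.imK]
  | 8, x, y =>
      let z : ℍ[ℝ] × ℍ[ℝ] :=
        cayleyMul
          (quaternionOf (x 0) (x 1) (x 2) (x 3),
            quaternionOf (x 4) (x 5) (x 6) (x 7))
          (quaternionOf (y 0) (y 1) (y 2) (y 3),
            quaternionOf (y 4) (y 5) (y 6) (y 7))
      ![z.1.re, z.1.imI, z.1.imJ, z.1.imK, z.2.re, z.2.imI, z.2.imJ, z.2.imK]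
  | _, _, _ => 0

/-- The first half `x` of a point `(x, y)` of `ℝ²ⁿ = ℝⁿ × ℝⁿ`. -/
def firstHalf {n : ℕ} (z : EuclideanSpace ℝ (Fin (2 * n))) : EuclideanSpace ℝ (Fin n) :=
  WithLp.toLp 2 fun i => z ⟨i, by omega⟩

/-- The second half `y` of a point `(x, y)` of `ℝ²ⁿ = ℝⁿ × ℝⁿ`. -/
def secondHalf {n : ℕ} (z : EuclideanSpace ℝ (Fin (2 * n))) : EuclideanSpace ℝ (Fin n) :=
  WithLp.toLp 2 fun i => z ⟨n + i, by omega⟩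

/-- The Hopf construction map `H(x, y) = (‖x‖² - ‖y‖², 2 x y)` of the standard multiplication
on `ℝⁿ`, as a map `ℝ²ⁿ → ℝⁿ⁺¹`. -/
def hopfConstruction (n : ℕ) (z : EuclideanSpace ℝ (Fin (2 * n))) :
    EuclideanSpace ℝ (Fin (n + 1)) :=
  WithLp.toLp 2 (Fin.cons (‖firstHalf z‖ ^ 2 - ‖secondHalf z‖ ^ 2)
    (2 • standardMul n (firstHalf z).ofLp (secondHalf z).ofLp))

end

/-! Pulling back linear functions and products of orthogonal linear functions shows that the
components of φ are quadratic forms of trace-free symmetric operators `T a` such that, for each x,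
the vectors `T a x` are orthogonal and of equal length
(`QuadraticHarmonicMorphisms.exists_operators`). Polarizing, distinct `T a` anticommute.

If φ ≠ 0, then `T 0` has an eigenvalue c ≠ 0. The other n operators exchange the eigenspaces of c
and -c and send an eigenvector to n orthogonal nonzero vectors, so each eigenspace has dimension at
least n and together they fill ℝ²ⁿ. In this splitting `T 0` contributes c(‖x‖² - ‖y‖²), while the
other operators are off-diagonal and contribute 2cβ(x, y) with ‖β(x, y)‖ = ‖x‖‖y‖
(`IsCliffordFamily.exists_pairing`).

Such a β becomes the product of a unital composition algebra after isometric changes of the factors,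
and Hurwitz's theorem, proved by repeated Cayley-Dickson doubling, identifies that algebra with the
standard one (`exists_isotopy_standardMul`). So φ is cH up to isometries.

Finally ‖φ z‖ = c‖z‖² and φ maps rays to rays, so the statement on spheres is the Euclidean one
applied to functions constant on rays. -/

open scoped RealInnerProductSpace

/-! ### Unital composition algebras over the reals -/

/-- A (not necessarily associative) unital algebra structure on a real inner product space whose
norm is multiplicative. -/
structure UnitalComposition (V : Type*) [NormedAddCommGroup V] [InnerProductSpace ℝ V] where
  mul : V →ₗ[ℝ] V →ₗ[ℝ] V
  one : V
  norm_one : ‖one‖ = 1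
  one_mul : ∀ x, mul one x = x
  mul_one : ∀ x, mul x one = x
  norm_mul : ∀ x y, ‖mul x y‖ = ‖x‖ * ‖y‖

namespace UnitalComposition

variable {V : Type*} [NormedAddCommGroup V] [InnerProductSpace ℝ V] (K : UnitalComposition V)

/-- Conjugation, the reflection in the line spanned by the unit. -/
noncomputable def conj (x : V) : V := (2 * ⟪x, K.one⟫) • K.one - x

lemma inner_one_one : ⟪K.one, K.one⟫ = 1 := by
  rw [real_inner_self_eq_norm_sq, K.norm_one]; norm_num

lemma inner_mul_self (x y : V) : ⟪K.mul x y, K.mul x y⟫ = ⟪x, x⟫ * ⟪y, y⟫ := by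
  simp only [real_inner_self_eq_norm_sq, K.norm_mul, mul_pow]

lemma inner_mul_mul_right (x z y : V) : ⟪K.mul x y, K.mul z y⟫ = ⟪x, z⟫ * ⟪y, y⟫ := by
  have h := K.inner_mul_self (x + z) y
  simp only [map_add, LinearMap.add_apply, inner_add_left, inner_add_right,
    K.inner_mul_self] at h
  rw [real_inner_comm (K.mul x y) (K.mul z y), real_inner_comm x z] at h
  linarith

lemma inner_mul_mul_left (x y z : V) : ⟪K.mul x y, K.mul x z⟫ = ⟪x, x⟫ * ⟪y, z⟫ := by
  have h := K.inner_mul_self x (y + z)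
  simp only [map_add, inner_add_left, inner_add_right, K.inner_mul_self] at h
  rw [real_inner_comm (K.mul x y) (K.mul x z), real_inner_comm y z] at h
  linarith

/-- Full polarization of the multiplicativity of the norm. Setting one of the four entries to the
unit yields the adjoints of the multiplications. -/
lemma inner_mul_mul_add (x y z w : V) :
    ⟪K.mul x y, K.mul z w⟫ + ⟪K.mul x w, K.mul z y⟫ = 2 * (⟪x, z⟫ * ⟪y, w⟫) := by
  have h := K.inner_mul_mul_right x z (y + w)
  simp only [map_add, inner_add_left, inner_add_right, K.inner_mul_mul_right] at h
  rw [real_inner_comm y w] at h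
  linarith

lemma conj_conj (x : V) : K.conj (K.conj x) = x := by
  simp only [conj, inner_sub_left, inner_smul_left, K.inner_one_one]
  simp
  module

lemma inner_conj_left (x y : V) : ⟪K.conj x, y⟫ = ⟪x, K.conj y⟫ := by
  simp only [conj, inner_sub_left, inner_sub_right, inner_smul_left, inner_smul_right,
    real_inner_comm K.one y]
  simp
  ring

lemma inner_mul_left (x y z : V) : ⟪K.mul x y, z⟫ = ⟪y, K.mul (K.conj x) z⟫ := by
  have h := K.inner_mul_mul_add x y K.one z
  simp only [K.one_mul] at h
  simp only [conj, map_sub, map_smul, LinearMap.sub_apply, LinearMap.smul_apply, K.one_mul,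
    inner_sub_right, inner_smul_right]
  rw [real_inner_comm (K.mul x z) y]
  linarith

lemma inner_mul_right (x y z : V) : ⟪K.mul x y, z⟫ = ⟪x, K.mul z (K.conj y)⟫ := by
  have h := K.inner_mul_mul_add x y z K.one
  simp only [K.mul_one] at h
  simp only [conj, map_sub, map_smul, K.mul_one, inner_sub_right, inner_smul_right]
  linarith

/-- Pairing with z moves x across as an adjoint. This identity and its mirror image stand in for
associativity. -/
lemma conj_mul_mul (x y : V) : K.mul (K.conj x) (K.mul x y) = ⟪x, x⟫ • y := by
  refine ext_inner_right ℝ fun z => ?_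
  rw [K.inner_mul_left, K.conj_conj, K.inner_mul_mul_left, inner_smul_left]
  simp

lemma mul_mul_conj (y x : V) : K.mul (K.mul y x) (K.conj x) = ⟪x, x⟫ • y := by
  refine ext_inner_right ℝ fun z => ?_
  rw [K.inner_mul_right, K.conj_conj, K.inner_mul_mul_right, inner_smul_left]
  simp [mul_comm]

lemma conj_add (x y : V) : K.conj (x + y) = K.conj x + K.conj y := by
  simp only [conj, inner_add_left]; module

/-- For orthogonal x and z the right side vanishes, so the two left factors may be exchanged up to
sign and conjugation. The doubling formulas come from this. -/
lemma conj_mul_mul_add (x z y : V) :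
    K.mul (K.conj x) (K.mul z y) + K.mul (K.conj z) (K.mul x y) = (2 * ⟪x, z⟫) • y := by
  have h := K.conj_mul_mul (x + z) y
  simp only [K.conj_add, map_add, LinearMap.add_apply, K.conj_mul_mul, inner_add_left,
    inner_add_right] at h
  rw [real_inner_comm x z] at h
  linear_combination (norm := module) h

lemma mul_mul_conj_add (y x z : V) :
    K.mul (K.mul y x) (K.conj z) + K.mul (K.mul y z) (K.conj x) = (2 * ⟪x, z⟫) • y := by
  have h := K.mul_mul_conj y (x + z)
  simp only [K.conj_add, map_add, LinearMap.add_apply, K.mul_mul_conj, inner_add_left,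
    inner_add_right] at h
  rw [real_inner_comm x z] at h
  linear_combination (norm := module) h

lemma conj_mul (x y : V) : K.conj (K.mul x y) = K.mul (K.conj y) (K.conj x) := by
  refine ext_inner_right ℝ fun z => ?_
  rw [K.inner_conj_left, K.inner_mul_left, K.inner_mul_left, K.conj_conj,
    K.inner_conj_left, ← K.inner_conj_left, real_inner_comm, K.inner_mul_right, K.conj_conj]

lemma conj_eq_neg {l : V} (hl : ⟪l, K.one⟫ = 0) : K.conj l = -l := by
  simp [conj, hl]

/-! #### Cayley-Dickson doubling -/

/-- A linear map from a star algebra compatible with unit, conjugation, multiplication. -/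
structure Hom (A : Type*) [Ring A] [Module ℝ A] [Star A] where
  toFun : A →ₗ[ℝ] V
  map_one : toFun 1 = K.one
  map_star : ∀ a, toFun (star a) = K.conj (toFun a)
  map_mul : ∀ a b, toFun (a * b) = K.mul (toFun a) (toFun b)

variable {K} {A : Type*} [Ring A] [Module ℝ A] [Star A] (ι : K.Hom A)

variable {l : V} (hl : ∀ a, ⟪l, ι.toFun a⟫ = 0) (hl1 : ‖l‖ = 1)
include hl

lemma Hom.conj_perp : K.conj l = -l :=
  K.conj_eq_neg (by rw [← ι.map_one]; exact hl 1)

/-- The product with l is again orthogonal to the unit, so conjugation negates it; conjugation also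
reverses products. -/
lemma Hom.mul_perp (d : A) : K.mul (ι.toFun d) l = K.mul l (K.conj (ι.toFun d)) := by
  have h : K.conj (K.mul (ι.toFun d) l) = -K.mul (ι.toFun d) l := by
    apply K.conj_eq_neg
    rw [K.inner_mul_left, K.mul_one, ← ι.map_star, hl]
  rw [K.conj_mul, ι.conj_perp hl] at h
  simpa using h.symm

/-- Exchange the orthogonal elements l and the conjugate of a by `conj_mul_mul_add`, then use
`mul_perp` to return l to the right. This reverses the order of a and d. -/
lemma Hom.mul_mul_perp (a d : A) :
    K.mul (ι.toFun a) (K.mul (ι.toFun d) l) = K.mul (ι.toFun (d * a)) l := by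
  have h := K.conj_mul_mul_add (K.conj (ι.toFun a)) l (K.conj (ι.toFun d))
  rw [K.conj_conj, ι.conj_perp hl, ← ι.map_star a, real_inner_comm, hl, ← ι.mul_perp hl,
    ι.map_star, ← K.conj_mul, ← ι.map_mul] at h
  simp only [map_neg, LinearMap.neg_apply, ← ι.mul_perp hl, mul_zero, zero_smul] at h
  exact eq_of_sub_eq_zero (by simpa [sub_eq_add_neg] using h)

lemma Hom.perp_mul (b c : A) :
    K.mul (K.mul (ι.toFun b) l) (ι.toFun c) = K.mul (ι.toFun (b * star c)) l := by
  have h := K.mul_mul_conj_add (ι.toFun b) l (K.conj (ι.toFun c))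
  rw [K.conj_conj, ι.conj_perp hl, ← ι.map_star, hl, ← ι.map_mul] at h
  simp only [map_neg, mul_zero, zero_smul] at h
  exact eq_of_sub_eq_zero (by simpa [sub_eq_add_neg] using h)

include hl1 in
-- Here the exchanged elements bl and l need not be orthogonal. The extra term 2⟪b, 1⟫ is what turns
-- the conjugate of b into -b.
lemma Hom.perp_mul_perp (b d : A) :
    K.mul (K.mul (ι.toFun b) l) (K.mul (ι.toFun d) l) = -ι.toFun (star d * b) := by
  have hll : ⟪l, l⟫ = 1 := by rw [real_inner_self_eq_norm_sq, hl1]; norm_num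
  have hc : K.conj (K.mul (ι.toFun b) l) = -K.mul (ι.toFun b) l := by
    apply K.conj_eq_neg
    rw [K.inner_mul_left, K.mul_one, ← ι.map_star, hl]
  have h := K.conj_mul_mul_add (K.mul (ι.toFun b) l) l (K.conj (ι.toFun d))
  have h2 : ⟪K.mul (ι.toFun b) l, l⟫ = ⟪ι.toFun b, K.one⟫ := by
    have := K.inner_mul_mul_right (ι.toFun b) K.one l
    rwa [K.one_mul, hll, _root_.mul_one] at this
  have h3 : K.mul l (K.mul (K.mul (ι.toFun b) l) (K.conj (ι.toFun d))) =
      -K.conj (K.mul (ι.toFun b) (K.conj (K.conj (ι.toFun d)))) := by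
    rw [← ι.map_star, ι.perp_mul hl, ι.mul_perp hl, ι.map_mul, ι.map_star, ι.map_star]
    have := K.conj_mul_mul l (K.conj (K.mul (ι.toFun b) (K.conj (K.conj (ι.toFun d)))))
    rw [ι.conj_perp hl, hll, one_smul] at this
    conv_rhs => rw [← this]
    simp
  rw [hc, ι.conj_perp hl, h2, ← ι.mul_perp hl] at h
  simp only [map_neg, LinearMap.neg_apply] at h
  rw [h3, K.conj_conj, K.conj_mul] at h
  have h4 : K.conj (ι.toFun b) = (2 * ⟪ι.toFun b, K.one⟫) • K.one - ι.toFun b := rfl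
  rw [h4, map_sub, map_smul, K.mul_one] at h
  rw [ι.map_mul, ι.map_star]
  linear_combination (norm := module) -h

include hl1 in
/-- The multiplication of the double of a subalgebra is given by the Cayley-Dickson formula. -/
lemma Hom.double_mul (a b c d : A) :
    K.mul (ι.toFun a + K.mul (ι.toFun b) l) (ι.toFun c + K.mul (ι.toFun d) l) =
      ι.toFun (a * c - star d * b) + K.mul (ι.toFun (d * a + b * star c)) l := by
  simp only [map_add, map_sub, LinearMap.add_apply, ι.mul_mul_perp hl, ι.perp_mul hl,
    ι.perp_mul_perp hl hl1, ← ι.map_mul]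
  abel

lemma Hom.double_conj (a b : A) :
    K.conj (ι.toFun a + K.mul (ι.toFun b) l) = ι.toFun (star a) - K.mul (ι.toFun b) l := by
  rw [K.conj_add, ι.map_star, sub_eq_add_neg]
  congr 1
  apply K.conj_eq_neg
  rw [K.inner_mul_left, K.mul_one, ← ι.map_star, hl]

include hl1 in
lemma Hom.norm_double_sq (a b : A) :
    ‖ι.toFun a + K.mul (ι.toFun b) l‖ ^ 2 = ‖ι.toFun a‖ ^ 2 + ‖ι.toFun b‖ ^ 2 := by
  have h : ⟪ι.toFun a, K.mul (ι.toFun b) l⟫ = 0 := by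
    rw [real_inner_comm, K.inner_mul_left, ← ι.map_star, ← ι.map_mul, hl]
  rw [norm_add_sq_real, h, K.norm_mul, hl1]
  ring

omit hl in
/-- If the subalgebra has smaller dimension than the whole space, it can be doubled. -/
lemma Hom.exists_perp [FiniteDimensional ℝ V]
    (h : Module.finrank ℝ A < Module.finrank ℝ V) [Module.Finite ℝ A] :
    ∃ l : V, ‖l‖ = 1 ∧ ∀ a, ⟪l, ι.toFun a⟫ = 0 := by
  have h1 : (LinearMap.range ι.toFun) ≠ ⊤ := by
    intro h2
    have := LinearMap.finrank_range_le ι.toFun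
    rw [h2, finrank_top] at this
    omega
  have h2 : (LinearMap.range ι.toFun)ᗮ ≠ ⊥ := by
    rwa [Ne, Submodule.orthogonal_eq_bot_iff]
  obtain ⟨w, hw, hw0⟩ := Submodule.exists_mem_ne_zero_of_ne_bot h2
  refine ⟨(‖w‖)⁻¹ • w, by simp [norm_smul, hw0], fun a => ?_⟩
  rw [inner_smul_left, real_inner_comm, (Submodule.mem_orthogonal _ _).1 hw _ ⟨a, rfl⟩]
  simp

end UnitalComposition

section QuaternionOf

variable (a b c d : ℝ)

@[simp] lemma quaternionOf_re : (quaternionOf a b c d).re = a := rfl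

@[simp] lemma quaternionOf_imI : (quaternionOf a b c d).imI = b := rfl

@[simp] lemma quaternionOf_imJ : (quaternionOf a b c d).imJ = c := rfl

@[simp] lemma quaternionOf_imK : (quaternionOf a b c d).imK = d := rfl

end QuaternionOf

/-! ### Embedding the real, complex, quaternionic and Cayley numbers; Hurwitz's theorem. -/

namespace UnitalComposition

variable {V : Type*} [NormedAddCommGroup V] [InnerProductSpace ℝ V] (K : UnitalComposition V)

/-- The embedding of the real numbers. -/
noncomputable def realHom : K.Hom ℝ where
  toFun := LinearMap.toSpanSingleton ℝ V K.one
  map_one := by simp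
  map_star a := by
    simp only [conj, LinearMap.toSpanSingleton_apply, inner_smul_left, K.inner_one_one,
      star_trivial]
    simp
    module
  map_mul a b := by simp [K.one_mul, smul_smul, mul_comm]

variable {K}

/-- The double of an embedding `A → V`, as a linear map on a module `B` whose elements are
described by pairs of elements of `A`. -/
noncomputable def Hom.doubleMap {A B : Type*} [Ring A] [Module ℝ A] [Star A] [AddCommGroup B]
    [Module ℝ B] (ι : K.Hom A) (l : V) (p q : B →ₗ[ℝ] A) : B →ₗ[ℝ] V :=
  ι.toFun ∘ₗ p + K.mul.flip l ∘ₗ ι.toFun ∘ₗ q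

lemma Hom.doubleMap_apply {A B : Type*} [Ring A] [Module ℝ A] [Star A] [AddCommGroup B]
    [Module ℝ B] (ι : K.Hom A) (l : V) (p q : B →ₗ[ℝ] A) (x : B) :
    ι.doubleMap l p q x = ι.toFun (p x) + K.mul (ι.toFun (q x)) l := rfl

/-- Embedding of a Cayley-Dickson double that is again a ring. -/
noncomputable def Hom.double {A B : Type*} [Ring A] [Module ℝ A] [Star A] [Ring B] [Module ℝ B]
    [Star B] (ι : K.Hom A) {l : V} (hl : ∀ a, ⟪l, ι.toFun a⟫ = 0) (hl1 : ‖l‖ = 1)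
    (p q : B →ₗ[ℝ] A) (hp1 : p 1 = 1) (hq1 : q 1 = 0) (hps : ∀ x, p (star x) = star (p x))
    (hqs : ∀ x, q (star x) = -q x) (hpm : ∀ x y, p (x * y) = p x * p y - star (q y) * q x)
    (hqm : ∀ x y, q (x * y) = q y * p x + q x * star (p y)) : K.Hom B where
  toFun := ι.doubleMap l p q
  map_one := by simp [ι.doubleMap_apply, hp1, hq1, ι.map_one]
  map_star a := by
    rw [ι.doubleMap_apply, ι.doubleMap_apply, ι.double_conj hl, hps, hqs]
    simp [sub_eq_add_neg]
  map_mul a b := by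
    rw [ι.doubleMap_apply, ι.doubleMap_apply, ι.doubleMap_apply, ι.double_mul hl hl1, hpm, hqm]

/-- The first complex coordinate of a quaternion written as `a + b j`. -/
noncomputable def quaternionFst : ℍ[ℝ] →ₗ[ℝ] ℂ where
  toFun x := ⟨x.re, x.imI⟩
  map_add' x y := by apply Complex.ext <;> simp
  map_smul' x y := by apply Complex.ext <;> simp

/-- The second complex coordinate of a quaternion written as `a + b j`. -/
noncomputable def quaternionSnd : ℍ[ℝ] →ₗ[ℝ] ℂ where
  toFun x := ⟨x.imJ, x.imK⟩
  map_add' x y := by apply Complex.ext <;> simp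
  map_smul' x y := by apply Complex.ext <;> simp

variable (K)

lemma norm_realHom_sq (a : ℝ) : ‖K.realHom.toFun a‖ ^ 2 = a ^ 2 := by
  simp [realHom, norm_smul, K.norm_one]

variable [FiniteDimensional ℝ V]

lemma exists_complexHom (h : 1 < Module.finrank ℝ V) :
    ∃ ι : K.Hom ℂ, ∀ z, ‖ι.toFun z‖ ^ 2 = z.re ^ 2 + z.im ^ 2 := by
  obtain ⟨l, hl1, hl⟩ := K.realHom.exists_perp (by simpa using h)
  refine ⟨K.realHom.double hl hl1 Complex.reLm Complex.imLm (by simp) (by simp) (by simp)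
    (by simp) (by simp [mul_comm]) (fun x y => ?_), fun z => ?_⟩
  · simp; ring
  · change ‖K.realHom.doubleMap l _ _ z‖ ^ 2 = _
    rw [Hom.doubleMap_apply, Hom.norm_double_sq _ hl hl1, norm_realHom_sq, norm_realHom_sq]
    rfl

lemma exists_quaternionHom (h : 2 < Module.finrank ℝ V) :
    ∃ ι : K.Hom ℍ[ℝ], ∀ z, ‖ι.toFun z‖ ^ 2 = z.re ^ 2 + z.imI ^ 2 + z.imJ ^ 2 + z.imK ^ 2 := by
  obtain ⟨ι, hι⟩ := K.exists_complexHom (by omega)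
  obtain ⟨l, hl1, hl⟩ := ι.exists_perp (by simpa using h)
  refine ⟨ι.double hl hl1 quaternionFst quaternionSnd ?_ ?_ ?_ ?_ ?_ ?_, fun z => ?_⟩
  · apply Complex.ext <;> simp [quaternionFst]
  · apply Complex.ext <;> simp [quaternionSnd]
  · intro x; apply Complex.ext <;> simp [quaternionFst]
  · intro x; apply Complex.ext <;> simp [quaternionSnd]
  · intro x y; apply Complex.ext <;> simp [quaternionFst, quaternionSnd] <;> ring
  · intro x y; apply Complex.ext <;> simp [quaternionFst, quaternionSnd] <;> ring
  · change ‖ι.doubleMap l _ _ z‖ ^ 2 = _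
    rw [Hom.doubleMap_apply, Hom.norm_double_sq _ hl hl1, hι, hι]
    simp [quaternionFst, quaternionSnd, add_assoc]

/-- The Cayley numbers are not associative, so the target of `Hom.double` is not available; a linear
map respecting `cayleyMul` is enough for the last doubling. -/
lemma exists_cayleyMap (h : 4 < Module.finrank ℝ V) :
    ∃ f : ℍ[ℝ] × ℍ[ℝ] →ₗ[ℝ] V, (∀ x y, f (cayleyMul x y) = K.mul (f x) (f y)) ∧
      ∀ z, ‖f z‖ ^ 2 = z.1.re ^ 2 + z.1.imI ^ 2 + z.1.imJ ^ 2 + z.1.imK ^ 2 +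
        (z.2.re ^ 2 + z.2.imI ^ 2 + z.2.imJ ^ 2 + z.2.imK ^ 2) := by
  obtain ⟨ι, hι⟩ := K.exists_quaternionHom (by omega)
  obtain ⟨l, hl1, hl⟩ := ι.exists_perp (by simpa [Quaternion.finrank_eq_four] using h)
  refine ⟨ι.doubleMap l (LinearMap.fst ..) (LinearMap.snd ..), fun x y => ?_, fun z => ?_⟩
  · rw [ι.doubleMap_apply, ι.doubleMap_apply, ι.doubleMap_apply, ι.double_mul hl hl1]
    rfl
  · rw [Hom.doubleMap_apply, Hom.norm_double_sq _ hl hl1, hι, hι]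
    rfl

/-- Hurwitz's theorem: a unital composition algebra of dimension `n ∈ {1, 2, 4, 8}` is
isometrically isomorphic to the standard one. -/
theorem exists_isometry {n : ℕ} (hn : n = 1 ∨ n = 2 ∨ n = 4 ∨ n = 8)
    (hV : Module.finrank ℝ V = n) :
    ∃ Φ : EuclideanSpace ℝ (Fin n) ≃ₗᵢ[ℝ] V, ∀ s t : EuclideanSpace ℝ (Fin n),
      Φ (WithLp.toLp 2 (standardMul n s.ofLp t.ofLp)) = K.mul (Φ s) (Φ t) := by
  -- A linear map preserving the norm is injective, hence bijective because the dimensions agree.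
  suffices h : ∃ f : EuclideanSpace ℝ (Fin n) →ₗ[ℝ] V, (∀ s, ‖f s‖ ^ 2 = ∑ i, s i ^ 2) ∧
      ∀ s t : EuclideanSpace ℝ (Fin n),
        f (WithLp.toLp 2 (standardMul n s.ofLp t.ofLp)) = K.mul (f s) (f t) by
    obtain ⟨f, hf, hm⟩ := h
    let g : EuclideanSpace ℝ (Fin n) →ₗᵢ[ℝ] V := ⟨f, fun s => by
      rw [← sq_eq_sq₀ (norm_nonneg _) (norm_nonneg _), hf, EuclideanSpace.real_norm_sq_eq]⟩
    exact ⟨g.toLinearIsometryEquiv (by simp [hV]), hm⟩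
  rcases hn with rfl | rfl | rfl | rfl
  · let c : EuclideanSpace ℝ (Fin 1) →ₗ[ℝ] ℝ :=
      { toFun := fun s => s 0, map_add' := by simp, map_smul' := by simp }
    refine ⟨K.realHom.toFun ∘ₗ c, fun s => ?_, fun s t => ?_⟩
    · rw [LinearMap.comp_apply, norm_realHom_sq, Fin.sum_univ_one]
      rfl
    · simp only [LinearMap.comp_apply]
      rw [← K.realHom.map_mul]
      rfl
  · obtain ⟨ι, hι⟩ := K.exists_complexHom (by omega)
    let c : EuclideanSpace ℝ (Fin 2) →ₗ[ℝ] ℂ :=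
      { toFun := fun s => ⟨s 0, s 1⟩
        map_add' := fun x y => by apply Complex.ext <;> simp
        map_smul' := fun x y => by apply Complex.ext <;> simp }
    refine ⟨ι.toFun ∘ₗ c, fun s => ?_, fun s t => ?_⟩
    · simp [hι, c, Fin.sum_univ_succ]
    · simp only [LinearMap.comp_apply]
      rw [← ι.map_mul]
      rfl
  · obtain ⟨ι, hι⟩ := K.exists_quaternionHom (by omega)
    let c : EuclideanSpace ℝ (Fin 4) →ₗ[ℝ] ℍ[ℝ] :=
      { toFun := fun s => quaternionOf (s 0) (s 1) (s 2) (s 3)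
        map_add' := fun x y => by ext <;> simp
        map_smul' := fun x y => by ext <;> simp }
    refine ⟨ι.toFun ∘ₗ c, fun s => ?_, fun s t => ?_⟩
    · rw [LinearMap.comp_apply, hι, Fin.sum_univ_four]; rfl
    · simp only [LinearMap.comp_apply]
      rw [← ι.map_mul]
      rfl
  · obtain ⟨f, hm, hf⟩ := K.exists_cayleyMap (by omega)
    let c : EuclideanSpace ℝ (Fin 8) →ₗ[ℝ] ℍ[ℝ] × ℍ[ℝ] :=
      { toFun := fun s => (quaternionOf (s 0) (s 1) (s 2) (s 3),
          quaternionOf (s 4) (s 5) (s 6) (s 7))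
        map_add' := fun x y => by ext <;> simp
        map_smul' := fun x y => by ext <;> simp }
    refine ⟨f ∘ₗ c, fun s => ?_, fun s t => ?_⟩
    · rw [LinearMap.comp_apply, hf, Fin.sum_univ_eight, ← add_assoc, ← add_assoc, ← add_assoc]
      rfl
    · simp only [LinearMap.comp_apply]
      rw [← hm]
      rfl

end UnitalComposition

/-! ### From norm-multiplicative pairings to unital algebras. -/

/-- A composition of quadratic forms in `n ∈ {1, 2, 4, 8}` variables is isotopic, through
isometries, to the standard multiplication. -/
theorem exists_isotopy_standardMul {n : ℕ} (hn : n = 1 ∨ n = 2 ∨ n = 4 ∨ n = 8)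
    {X Y W : Type*} [NormedAddCommGroup X] [InnerProductSpace ℝ X] [FiniteDimensional ℝ X]
    [NormedAddCommGroup Y] [InnerProductSpace ℝ Y] [FiniteDimensional ℝ Y]
    [NormedAddCommGroup W] [InnerProductSpace ℝ W] [FiniteDimensional ℝ W]
    (hX : Module.finrank ℝ X = n) (hY : Module.finrank ℝ Y = n) (hW : Module.finrank ℝ W = n)
    (β : X →ₗ[ℝ] Y →ₗ[ℝ] W) (hβ : ∀ x y, ‖β x y‖ = ‖x‖ * ‖y‖) :
    ∃ (A : X ≃ₗᵢ[ℝ] EuclideanSpace ℝ (Fin n)) (B : Y ≃ₗᵢ[ℝ] EuclideanSpace ℝ (Fin n))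
      (C : W ≃ₗᵢ[ℝ] EuclideanSpace ℝ (Fin n)), ∀ x y,
        C (β x y) = WithLp.toLp 2 (standardMul n (A x).ofLp (B y).ofLp) := by
  have : Nontrivial X := Module.nontrivial_of_finrank_pos (R := ℝ) (by omega)
  have : Nontrivial Y := Module.nontrivial_of_finrank_pos (R := ℝ) (by omega)
  obtain ⟨u, hu⟩ := exists_norm_eq X zero_le_one
  obtain ⟨v, hv⟩ := exists_norm_eq Y zero_le_one
  let R : X ≃ₗᵢ[ℝ] W := LinearIsometry.toLinearIsometryEquiv
    ⟨β.flip v, fun x => by simp [hβ, hv]⟩ (by omega)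
  let L : Y ≃ₗᵢ[ℝ] W := LinearIsometry.toLinearIsometryEquiv
    ⟨β u, fun x => by simp [hβ, hu]⟩ (by omega)
  have hR : ∀ x, R x = β x v := fun _ => rfl
  have hL : ∀ y, L y = β u y := fun _ => rfl
  have hRu : R.symm (β u v) = u := by rw [← hR, LinearIsometryEquiv.symm_apply_apply]
  have hLv : L.symm (β u v) = v := by rw [← hL, LinearIsometryEquiv.symm_apply_apply]
  -- Kaplansky's trick: β(·, v) and β(u, ·) are isometries for unit vectors u, v, and transporting β
  -- to W along them creates the two-sided unit β(u, v).
  let K : UnitalComposition W :=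
    { mul := β.compl₁₂ R.symm.toLinearEquiv.toLinearMap L.symm.toLinearEquiv.toLinearMap
      one := β u v
      norm_one := by simp [hβ, hu, hv]
      one_mul := fun x => by
        change β (R.symm (β u v)) (L.symm x) = x
        rw [hRu, ← hL, LinearIsometryEquiv.apply_symm_apply]
      mul_one := fun x => by
        change β (R.symm x) (L.symm (β u v)) = x
        rw [hLv, ← hR, LinearIsometryEquiv.apply_symm_apply]
      norm_mul := fun x y => by
        change ‖β (R.symm x) (L.symm y)‖ = _
        simp [hβ] }
  obtain ⟨Φ, hΦ⟩ := K.exists_isometry hn hW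
  refine ⟨R.trans Φ.symm, L.trans Φ.symm, Φ.symm, fun x y => ?_⟩
  rw [LinearIsometryEquiv.symm_apply_eq, hΦ]
  change _ = β (R.symm _) (L.symm _)
  simp

/-! ### Homogeneous quadratic polynomials as quadratic forms -/

/-- Degree-two forms are spanned by products of two variables, and each such product is the
quadratic form of a rank-one operator. -/
lemma exists_clm_of_isHomogeneous_two {m : ℕ} {p : MvPolynomial (Fin m) ℝ}
    (hp : p.IsHomogeneous 2) :
    ∃ T : EuclideanSpace ℝ (Fin m) →L[ℝ] EuclideanSpace ℝ (Fin m),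
      ∀ x, MvPolynomial.eval (fun i => x i) p = ⟪T x, x⟫ := by
  have h : p ∈ (Submodule.span ℝ (Set.range (MvPolynomial.X : Fin m → MvPolynomial (Fin m) ℝ))) *
      Submodule.span ℝ (Set.range (MvPolynomial.X : Fin m → MvPolynomial (Fin m) ℝ)) := by
    rw [← pow_two, ← MvPolynomial.homogeneousSubmodule_one_eq_span_X,
      MvPolynomial.homogeneousSubmodule_one_pow]
    exact hp
  clear hp
  rw [Submodule.span_mul_span] at h
  induction h using Submodule.span_induction with
  | mem y hy =>
    obtain ⟨_, ⟨i, rfl⟩, _, ⟨j, rfl⟩, rfl⟩ := Set.mem_mul.1 hy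
    refine ⟨(EuclideanSpace.proj i).smulRight (EuclideanSpace.single j 1), fun x => ?_⟩
    simp [inner_smul_left, EuclideanSpace.inner_single_left]
  | zero => exact ⟨0, by simp⟩
  | add y z _ _ hy hz =>
    obtain ⟨S, hS⟩ := hy
    obtain ⟨T, hT⟩ := hz
    exact ⟨S + T, fun x => by simp [hS, hT, inner_add_left]⟩
  | smul c y _ hy =>
    obtain ⟨S, hS⟩ := hy
    exact ⟨c • S, fun x => by simp [hS, inner_smul_left]⟩

/-- A homogeneous polynomial of degree two is the quadratic form of a symmetric operator. -/
lemma exists_symmetric_clm_of_isHomogeneous_two {m : ℕ} {p : MvPolynomial (Fin m) ℝ}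
    (hp : p.IsHomogeneous 2) :
    ∃ T : EuclideanSpace ℝ (Fin m) →L[ℝ] EuclideanSpace ℝ (Fin m),
      (∀ x y, ⟪T x, y⟫ = ⟪x, T y⟫) ∧
        ∀ x, MvPolynomial.eval (fun i => x i) p = ⟪T x, x⟫ := by
  obtain ⟨T, hT⟩ := exists_clm_of_isHomogeneous_two hp
  refine ⟨(1 / 2 : ℝ) • (T + T.adjoint), fun x y => ?_, fun x => ?_⟩
  · simp [inner_smul_left, inner_smul_right, inner_add_left, inner_add_right,
      ContinuousLinearMap.adjoint_inner_left, ContinuousLinearMap.adjoint_inner_right, add_comm]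
  · simp only [hT, smul_apply, add_apply,
      inner_smul_left, inner_add_left, ContinuousLinearMap.adjoint_inner_left]
    rw [real_inner_comm x (T x)]
    simp
    ring

/-- The quadratic form of an operator is a homogeneous polynomial of degree two. -/
lemma exists_isHomogeneous_two {m : ℕ}
    (T : EuclideanSpace ℝ (Fin m) →L[ℝ] EuclideanSpace ℝ (Fin m)) :
    ∃ p : MvPolynomial (Fin m) ℝ, p.IsHomogeneous 2 ∧
      ∀ x : EuclideanSpace ℝ (Fin m), ⟪T x, x⟫ = MvPolynomial.eval (fun i => x i) p := by
  refine ⟨∑ i, ∑ j, MvPolynomial.C (T (EuclideanSpace.single i 1) j) *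
    (MvPolynomial.X i * MvPolynomial.X j), ?_, fun x => ?_⟩
  · refine MvPolynomial.IsHomogeneous.sum _ _ _ fun i _ =>
      MvPolynomial.IsHomogeneous.sum _ _ _ fun j _ => ?_
    exact ((MvPolynomial.isHomogeneous_X ℝ i).mul (MvPolynomial.isHomogeneous_X ℝ j)).C_mul _
  · have h : T x = ∑ i, x i • T (EuclideanSpace.single i 1) := by
      conv_lhs => rw [← (EuclideanSpace.basisFun (Fin m) ℝ).sum_repr x]
      simp
    rw [h, sum_inner]
    simp only [inner_smul_left, PiLp.inner_apply, Finset.mul_sum, map_sum]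
    refine Finset.sum_congr rfl fun i _ => Finset.sum_congr rfl fun j _ => ?_
    simp
    ring

/-! ### Laplacians of quadratic forms -/

section Laplacian

open InnerProductSpace Laplacian

variable {E : Type*} [NormedAddCommGroup E] [InnerProductSpace ℝ E]

lemma hasFDerivAt_inner_clm_self {T : E →L[ℝ] E} (hT : ∀ x y, ⟪T x, y⟫ = ⟪x, T y⟫) (x : E) :
    HasFDerivAt (fun x => ⟪T x, x⟫) ((2 : ℝ) • innerSL ℝ (T x)) x := by
  convert! T.hasFDerivAt.inner ℝ (hasFDerivAt_id x) using 1
  ext v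
  simp [hT v x, real_inner_comm v, two_mul]

lemma hasFDerivAt_innerSL_comp (T : E →L[ℝ] E) (x : E) :
    HasFDerivAt (fun x => (2 : ℝ) • innerSL ℝ (T x)) ((2 : ℝ) • (innerSL ℝ).comp T) x :=
  (((innerSL ℝ).comp T).hasFDerivAt).const_smul (2 : ℝ)

variable [FiniteDimensional ℝ E]

lemma laplacian_eq_sum_of_hasFDerivAt {f : E → ℝ} {f' : E → E →L[ℝ] ℝ} {f'' : E →L[ℝ] E →L[ℝ] ℝ}
    {x : E} (h1 : ∀ y, HasFDerivAt f (f' y) y) (h2 : HasFDerivAt f' f'' x)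
    {ι : Type*} [Fintype ι] (b : OrthonormalBasis ι ℝ E) :
    (Δ f) x = ∑ i, f'' (b i) (b i) := by
  have h : fderiv ℝ f = f' := funext fun y => (h1 y).fderiv
  rw [laplacian_eq_iteratedFDeriv_orthonormalBasis f b]
  simp [iteratedFDeriv_two_apply, h, h2.fderiv]

lemma laplacian_inner_clm_self {T : E →L[ℝ] E} (hT : ∀ x y, ⟪T x, y⟫ = ⟪x, T y⟫) (x : E)
    {ι : Type*} [Fintype ι] (b : OrthonormalBasis ι ℝ E) :
    (Δ fun x => ⟪T x, x⟫) x = 2 * ∑ i, ⟪T (b i), b i⟫ := by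
  rw [laplacian_eq_sum_of_hasFDerivAt (hasFDerivAt_inner_clm_self hT)
    (hasFDerivAt_innerSL_comp T x) b, Finset.mul_sum]
  simp

/-- The Laplacian of a product of two quadratic forms with vanishing trace. -/
lemma laplacian_inner_clm_self_mul {S T : E →L[ℝ] E} (hS : ∀ x y, ⟪S x, y⟫ = ⟪x, S y⟫)
    (hT : ∀ x y, ⟪T x, y⟫ = ⟪x, T y⟫) (x : E) {ι : Type*} [Fintype ι]
    (b : OrthonormalBasis ι ℝ E) (hS0 : ∑ i, ⟪S (b i), b i⟫ = 0)
    (hT0 : ∑ i, ⟪T (b i), b i⟫ = 0) :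
    (Δ fun x => ⟪S x, x⟫ * ⟪T x, x⟫) x = 8 * ⟪S x, T x⟫ := by
  refine (laplacian_eq_sum_of_hasFDerivAt
    (fun y => (hasFDerivAt_inner_clm_self hS y).mul (hasFDerivAt_inner_clm_self hT y))
    (((hasFDerivAt_inner_clm_self hS x).smul (hasFDerivAt_innerSL_comp T x)).add
      ((hasFDerivAt_inner_clm_self hT x).smul (hasFDerivAt_innerSL_comp S x))) b).trans ?_
  rw [← b.sum_inner_mul_inner (S x) (T x)]
  have h : ∀ i, ⟪b i, T x⟫ = ⟪T x, b i⟫ := fun i => real_inner_comm _ _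
  -- The vanishing trace terms are put back so that both sides agree summand by summand.
  have key : 8 * ∑ i, ⟪S x, b i⟫ * ⟪b i, T x⟫ = 8 * ∑ i, ⟪S x, b i⟫ * ⟪b i, T x⟫ +
      2 * ⟪S x, x⟫ * ∑ i, ⟪T (b i), b i⟫ + 2 * ⟪T x, x⟫ * ∑ i, ⟪S (b i), b i⟫ := by
    rw [hS0, hT0]; ring
  rw [key]
  simp only [Finset.mul_sum, ← Finset.sum_add_distrib]
  refine Finset.sum_congr rfl fun i _ => ?_
  simp [h]
  ring

lemma harmonicOnNhd_inner (u : E) (s : Set E) : HarmonicOnNhd (fun x => ⟪u, x⟫) s := by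
  refine fun x _ => ⟨((innerSL ℝ u).contDiff).contDiffAt, Filter.Eventually.of_forall fun y => ?_⟩
  refine (laplacian_eq_sum_of_hasFDerivAt (fun y => (innerSL ℝ u).hasFDerivAt)
    (hasFDerivAt_const _ _) (stdOrthonormalBasis ℝ E)).trans ?_
  simp

/-- The product of two orthogonal linear forms is harmonic. -/
lemma harmonicOnNhd_inner_mul_inner {u w : E} (huw : ⟪u, w⟫ = 0) (s : Set E) :
    HarmonicOnNhd (fun x => ⟪u, x⟫ * ⟪w, x⟫) s := by
  refine fun x _ => ⟨((innerSL ℝ u).contDiff.mul (innerSL ℝ w).contDiff).contDiffAt,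
    Filter.Eventually.of_forall fun y => ?_⟩
  refine (laplacian_eq_sum_of_hasFDerivAt
    (fun y => ((innerSL ℝ u).hasFDerivAt).mul (innerSL ℝ w).hasFDerivAt)
    (((innerSL ℝ u).hasFDerivAt.smul (hasFDerivAt_const (innerSL ℝ w) y)).add
      ((innerSL ℝ w).hasFDerivAt.smul (hasFDerivAt_const (innerSL ℝ u) y)))
    (stdOrthonormalBasis ℝ E)).trans ?_
  have h := (stdOrthonormalBasis ℝ E).sum_inner_mul_inner u w
  simp only [real_inner_comm w] at h
  rw [(real_inner_comm u w).trans huw] at h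
  have h2 : 2 * ∑ i, ⟪u, stdOrthonormalBasis ℝ E i⟫ * ⟪w, stdOrthonormalBasis ℝ E i⟫ = 0 := by
    rw [h, mul_zero]
  simp only [Pi.zero_apply]
  rw [← h2, Finset.mul_sum]
  refine Finset.sum_congr rfl fun i _ => ?_
  simp
  ring

/-- Harmonicity is invariant under linear isometries of the domain. -/
lemma harmonicAt_comp_linearIsometryEquiv {f : E → ℝ} (L : E ≃ₗᵢ[ℝ] E) {x : E}
    (h : HarmonicAt f (L x)) : HarmonicAt (f ∘ L) x := by
  refine ⟨h.1.comp x L.contDiff.contDiffAt, ?_⟩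
  have hL : Filter.Tendsto L (nhds x) (nhds (L x)) := L.continuous.continuousAt
  filter_upwards [hL.eventually h.2] with y hy
  -- The Laplacian may be computed in any orthonormal basis; at the image point the image basis is
  -- used.
  rw [laplacian_eq_iteratedFDeriv_orthonormalBasis _ ((stdOrthonormalBasis ℝ E).map L)] at hy
  rw [laplacian_eq_iteratedFDeriv_stdOrthonormalBasis]
  simp only [Pi.zero_apply] at hy ⊢
  rw [← hy]
  refine Finset.sum_congr rfl fun i _ => ?_
  have := L.toContinuousLinearEquiv.iteratedFDerivWithin_comp_right f
    (uniqueDiffOn_univ (𝕜 := ℝ)) (x := y) (Set.mem_univ _) 2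
  simp only [Set.preimage_univ, iteratedFDerivWithin_univ] at this
  change iteratedFDeriv ℝ 2 (f ∘ L.toContinuousLinearEquiv) y _ = _
  rw [this]
  simp only [ContinuousMultilinearMap.compContinuousLinearMap_apply]
  congr 1
  ext j
  fin_cases j <;> rfl

end Laplacian

/-! ### Clifford systems from quadratic harmonic morphisms -/

/-- The components of a quadratic harmonic morphism are the quadratic forms of symmetric operators
`T a` such that, for every `x`, the vectors `T a x` are mutually orthogonal and of equal length. -/
theorem QuadraticHarmonicMorphisms.exists_operators {m n : ℕ}
    {φ : EuclideanSpace ℝ (Fin m) → EuclideanSpace ℝ (Fin n)}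
    (hφ : φ ∈ QuadraticHarmonicMorphisms m n) :
    ∃ T : Fin n → EuclideanSpace ℝ (Fin m) →L[ℝ] EuclideanSpace ℝ (Fin m),
      (∀ a x y, ⟪T a x, y⟫ = ⟪x, T a y⟫) ∧ (∀ x a, φ x a = ⟪T a x, x⟫) ∧
      (∀ a b x, a ≠ b → ⟪T a x, T b x⟫ = 0) ∧ ∀ a b x, ‖T a x‖ = ‖T b x‖ := by
  have h : ∀ a, ∃ T : EuclideanSpace ℝ (Fin m) →L[ℝ] EuclideanSpace ℝ (Fin m),
      (∀ x y, ⟪T x, y⟫ = ⟪x, T y⟫) ∧ ∀ x, φ x a = ⟪T x, x⟫ := fun a => by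
    obtain ⟨p, hp, hpx⟩ := hφ.2 a
    obtain ⟨T, hT, hTx⟩ := exists_symmetric_clm_of_isHomogeneous_two hp
    exact ⟨T, hT, fun x => by rw [hpx, hTx]⟩
  choose T hT hφT using h
  let b := stdOrthonormalBasis ℝ (EuclideanSpace ℝ (Fin m))
  -- Coordinate functions are harmonic, so each `T a` has trace zero.
  have htr : ∀ a, ∑ i, ⟪T a (b i), b i⟫ = 0 := fun a => by
    have h1 := (hφ.1.2 Set.univ _ isOpen_univ
      (harmonicOnNhd_inner (EuclideanSpace.single a (1 : ℝ)) _) 0 trivial).2.self_of_nhds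
    have h2 : (fun y : EuclideanSpace ℝ (Fin n) => ⟪EuclideanSpace.single a (1 : ℝ), y⟫) ∘ φ =
        fun x => ⟪T a x, x⟫ := by
      ext x; simp [EuclideanSpace.inner_single_left, hφT]
    rw [h2, laplacian_inner_clm_self (hT a) 0 b] at h1
    simpa using h1
  have hmul : ∀ (u w : EuclideanSpace ℝ (Fin n))
      (P Q : EuclideanSpace ℝ (Fin m) →L[ℝ] EuclideanSpace ℝ (Fin m)),
      ⟪u, w⟫ = 0 → (∀ x y, ⟪P x, y⟫ = ⟪x, P y⟫) → (∀ x y, ⟪Q x, y⟫ = ⟪x, Q y⟫) →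
      (∑ i, ⟪P (b i), b i⟫ = 0) → (∑ i, ⟪Q (b i), b i⟫ = 0) →
      (∀ x, ⟪u, φ x⟫ = ⟪P x, x⟫) → (∀ x, ⟪w, φ x⟫ = ⟪Q x, x⟫) → ∀ x, ⟪P x, Q x⟫ = 0 := by
    intro u w P Q huw hP hQ hP0 hQ0 hPφ hQφ x
    have h1 := (hφ.1.2 Set.univ _ isOpen_univ
      (harmonicOnNhd_inner_mul_inner huw _) x trivial).2.self_of_nhds
    have h2 : (fun y => ⟪u, y⟫ * ⟪w, y⟫) ∘ φ = fun x => ⟪P x, x⟫ * ⟪Q x, x⟫ := by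
      ext x; simp [hPφ, hQφ]
    rw [h2, laplacian_inner_clm_self_mul hP hQ x b hP0 hQ0] at h1
    simpa using h1
  have hort : ∀ a c x, a ≠ c → ⟪T a x, T c x⟫ = 0 := fun a c x hac =>
    hmul (EuclideanSpace.single a 1) (EuclideanSpace.single c 1) (T a) (T c)
      (by simp [EuclideanSpace.inner_single_left, hac]) (hT a) (hT c) (htr a) (htr c)
      (fun x => by simp [EuclideanSpace.inner_single_left, hφT])
      (fun x => by simp [EuclideanSpace.inner_single_left, hφT]) x
  refine ⟨T, hT, fun x a => hφT a x, hort, fun a c x => ?_⟩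
  by_cases hac : a = c
  · rw [hac]
  -- The sum and difference of two basis vectors are orthogonal; orthogonality of the corresponding
  -- images says that `T a x` and `T c x` have equal length.
  have h := hmul (EuclideanSpace.single a 1 + EuclideanSpace.single c 1)
    (EuclideanSpace.single a 1 - EuclideanSpace.single c 1) (T a + T c) (T a - T c)
    (by simp [inner_add_left, inner_sub_right, EuclideanSpace.inner_single_left, hac, Ne.symm hac])
    (fun x y => by simp [inner_add_left, inner_add_right, hT])
    (fun x y => by simp [inner_sub_left, inner_sub_right, hT])
    (by simp [inner_add_left, Finset.sum_add_distrib, htr])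
    (by simp [inner_sub_left, Finset.sum_sub_distrib, htr])
    (fun x => by simp [inner_add_left, EuclideanSpace.inner_single_left, hφT])
    (fun x => by simp [inner_sub_left, EuclideanSpace.inner_single_left, hφT]) x
  rw [add_apply, sub_apply, real_inner_add_sub_eq_zero_iff] at h
  exact h

section Clifford

variable {E : Type*} [NormedAddCommGroup E] [InnerProductSpace ℝ E]

/-- Operators `T a` that are symmetric and map every vector to an orthogonal family of vectors of
equal length. -/
structure IsCliffordFamily {ι : Type*} (T : ι → E →L[ℝ] E) : Prop where
  symm : ∀ a x y, ⟪T a x, y⟫ = ⟪x, T a y⟫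
  orth : ∀ a b x, a ≠ b → ⟪T a x, T b x⟫ = 0
  norm_eq : ∀ a b x, ‖T a x‖ = ‖T b x‖

namespace IsCliffordFamily

variable {ι : Type*} {T : ι → E →L[ℝ] E} (h : IsCliffordFamily T)
include h

lemma anticomm {a b : ι} (hab : a ≠ b) (x : E) : T a (T b x) = -T b (T a x) := by
  refine ext_inner_right ℝ fun y => ?_
  have h1 := h.orth a b (x + y) hab
  simp only [map_add, inner_add_left, inner_add_right, h.orth a b _ hab] at h1
  rw [inner_neg_left, h.symm a, h.symm b (T a x), real_inner_comm (T a y) (T b x)]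
  linarith

lemma apply_mem_eigenspace {a b : ι} (hab : a ≠ b) {c : ℝ} {x : E}
    (hx : x ∈ Module.End.eigenspace (T a : E →ₗ[ℝ] E) c) :
    T b x ∈ Module.End.eigenspace (T a : E →ₗ[ℝ] E) (-c) := by
  rw [Module.End.mem_eigenspace_iff] at hx ⊢
  simp only [ContinuousLinearMap.coe_coe] at hx ⊢
  rw [h.anticomm hab, hx]
  simp

lemma norm_apply {a : ι} {c : ℝ} {x : E} (hx : x ∈ Module.End.eigenspace (T a : E →ₗ[ℝ] E) c)
    (b : ι) : ‖T b x‖ = |c| * ‖x‖ := by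
  rw [Module.End.mem_eigenspace_iff, ContinuousLinearMap.coe_coe] at hx
  rw [h.norm_eq b a, hx, norm_smul, Real.norm_eq_abs]

end IsCliffordFamily

variable [FiniteDimensional ℝ E] {n : ℕ} {T : Fin (n + 1) → E →L[ℝ] E}

namespace IsCliffordFamily

/-- The n vectors `T j.succ x` are orthogonal, have length |c|‖x‖ ≠ 0, and lie in the opposite
eigenspace. -/
lemma le_finrank_eigenspace (h : IsCliffordFamily T) {c : ℝ} (hc : c ≠ 0) {x : E} (hx0 : x ≠ 0)
    (hx : x ∈ Module.End.eigenspace (T 0 : E →ₗ[ℝ] E) c) :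
    n ≤ Module.finrank ℝ (Module.End.eigenspace (T 0 : E →ₗ[ℝ] E) (-c)) := by
  have hli : LinearIndependent ℝ fun j : Fin n => T j.succ x := by
    refine linearIndependent_of_ne_zero_of_inner_eq_zero (fun j => ?_) fun i j hij =>
      h.orth _ _ _ (by simpa using hij)
    rw [← norm_ne_zero_iff, h.norm_apply hx]
    positivity
  let f : Fin n → Module.End.eigenspace (T 0 : E →ₗ[ℝ] E) (-c) := fun j =>
    ⟨T j.succ x, h.apply_mem_eigenspace (Fin.succ_ne_zero j).symm hx⟩
  have hf : LinearIndependent ℝ f := LinearIndependent.of_comp (Submodule.subtype _) hli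
  simpa using hf.fintype_card_le_finrank

lemma exists_eigenvalue_ne_zero {T : E →L[ℝ] E} (hT : ∀ x y, ⟪T x, y⟫ = ⟪x, T y⟫) (hT0 : T ≠ 0) :
    ∃ c : ℝ, c ≠ 0 ∧ ∃ x, x ≠ 0 ∧ x ∈ Module.End.eigenspace (T : E →ₗ[ℝ] E) c := by
  have hs : (T : E →ₗ[ℝ] E).IsSymmetric := hT
  by_contra! hcon
  apply hT0
  have : (T : E →ₗ[ℝ] E) = 0 := by
    refine (hs.eigenvectorBasis rfl).toBasis.ext fun i => ?_
    have h1 := hs.apply_eigenvectorBasis rfl i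
    by_cases hi : hs.eigenvalues rfl i = 0
    · simp [hi]
    · exact absurd (Module.End.mem_eigenspace_iff.2 h1)
        (hcon _ hi _ ((hs.eigenvectorBasis rfl).orthonormal.ne_zero i))
  exact ContinuousLinearMap.coe_injective this

/-- If `dim E = 2 n` and the family is nonzero, then `E` is the orthogonal sum of two
`n`-dimensional eigenspaces of `T 0`. -/
lemma exists_eigenspaces (h : IsCliffordFamily T) (hE : Module.finrank ℝ E = 2 * n)
    (hn : 0 < n) (hT0 : T 0 ≠ 0) : ∃ c : ℝ, 0 < c ∧
      Module.finrank ℝ (Module.End.eigenspace (T 0 : E →ₗ[ℝ] E) c) = n ∧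
      Module.finrank ℝ (Module.End.eigenspace (T 0 : E →ₗ[ℝ] E) (-c)) = n ∧
      ∀ z, T 0 (T 0 z) = (c * c) • z := by
  obtain ⟨d, hd, x, hx0, hx⟩ := exists_eigenvalue_ne_zero (h.symm 0) hT0
  have key : ∀ e : ℝ, e ≠ 0 → ∀ x, x ≠ 0 → x ∈ Module.End.eigenspace (T 0 : E →ₗ[ℝ] E) e →
      n ≤ Module.finrank ℝ (Module.End.eigenspace (T 0 : E →ₗ[ℝ] E) e) ∧
      n ≤ Module.finrank ℝ (Module.End.eigenspace (T 0 : E →ₗ[ℝ] E) (-e)) := by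
    intro e he x hx0 hx
    have h1 := h.le_finrank_eigenspace he hx0 hx
    refine ⟨?_, h1⟩
    have : Nontrivial (Module.End.eigenspace (T 0 : E →ₗ[ℝ] E) (-e)) :=
      Module.nontrivial_of_finrank_pos (R := ℝ) (by omega)
    -- An eigenvector for -e now exists, and the same bound applied to it returns to the eigenspace
    -- of e.
    obtain ⟨y, hy⟩ := exists_ne (0 : Module.End.eigenspace (T 0 : E →ₗ[ℝ] E) (-e))
    have h2 := h.le_finrank_eigenspace (neg_ne_zero.2 he) (by simpa using hy) y.2
    rwa [neg_neg] at h2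
  obtain ⟨c, hc, h1, h2⟩ : ∃ c : ℝ, 0 < c ∧
      n ≤ Module.finrank ℝ (Module.End.eigenspace (T 0 : E →ₗ[ℝ] E) c) ∧
      n ≤ Module.finrank ℝ (Module.End.eigenspace (T 0 : E →ₗ[ℝ] E) (-c)) := by
    obtain ⟨h1, h2⟩ := key d hd x hx0 hx
    rcases lt_or_gt_of_ne hd with hd' | hd'
    · exact ⟨-d, by linarith, h2, by rwa [neg_neg]⟩
    · exact ⟨d, hd', h1, h2⟩
  have hdisj : Disjoint (Module.End.eigenspace (T 0 : E →ₗ[ℝ] E) c)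
      (Module.End.eigenspace (T 0 : E →ₗ[ℝ] E) (-c)) :=
    Module.End.disjoint_genEigenspace _ (by intro h; linarith) _ _
  have h3 := Submodule.finrank_sup_add_finrank_inf_eq
    (Module.End.eigenspace (T 0 : E →ₗ[ℝ] E) c) (Module.End.eigenspace (T 0 : E →ₗ[ℝ] E) (-c))
  rw [disjoint_iff.1 hdisj, finrank_bot] at h3
  have h4 := Submodule.finrank_le (Module.End.eigenspace (T 0 : E →ₗ[ℝ] E) c ⊔
    Module.End.eigenspace (T 0 : E →ₗ[ℝ] E) (-c))
  refine ⟨c, hc, by omega, by omega, fun z => ?_⟩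
  have htop : Module.End.eigenspace (T 0 : E →ₗ[ℝ] E) c ⊔
      Module.End.eigenspace (T 0 : E →ₗ[ℝ] E) (-c) = ⊤ :=
    Submodule.eq_top_of_finrank_eq (by omega)
  obtain ⟨x, hx, y, hy, rfl⟩ := Submodule.mem_sup.1 (htop ▸ Submodule.mem_top : z ∈ _)
  rw [Module.End.mem_eigenspace_iff, ContinuousLinearMap.coe_coe] at hx hy
  simp only [map_add, hx, hy, map_smul]
  module

/-- Parseval's identity for y: dividing the n vectors `T j.succ x` by c‖x‖ gives an orthonormal
basis of the n-dimensional eigenspace of -c. -/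
lemma norm_sum_inner (h : IsCliffordFamily T) {c : ℝ} (hc : 0 < c)
    (hY : Module.finrank ℝ (Module.End.eigenspace (T 0 : E →ₗ[ℝ] E) (-c)) = n) {x y : E}
    (hx : x ∈ Module.End.eigenspace (T 0 : E →ₗ[ℝ] E) c)
    (hy : y ∈ Module.End.eigenspace (T 0 : E →ₗ[ℝ] E) (-c)) :
    ∑ j : Fin n, ⟪T j.succ x, y⟫ ^ 2 = (c * ‖x‖ * ‖y‖) ^ 2 := by
  by_cases hx0 : x = 0
  · simp [hx0]
  have hx1 : c * ‖x‖ ≠ 0 := by positivity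
  let f : Fin n → Module.End.eigenspace (T 0 : E →ₗ[ℝ] E) (-c) := fun j =>
    (c * ‖x‖)⁻¹ • ⟨T j.succ x, h.apply_mem_eigenspace (Fin.succ_ne_zero j).symm hx⟩
  have hf : Orthonormal ℝ f := by
    refine ⟨fun j => ?_, fun i j hij => ?_⟩
    · simp only [f, norm_smul, norm_inv, Submodule.coe_norm, h.norm_apply hx]
      rw [abs_of_pos hc, Real.norm_of_nonneg (by positivity), inv_mul_cancel₀ hx1]
    · simp only [f, inner_smul_left, inner_smul_right, Submodule.coe_inner]
      rw [h.orth _ _ _ (by simpa using hij)]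
      simp
  have hspan : ⊤ ≤ Submodule.span ℝ (Set.range f) := by
    rw [hf.linearIndependent.span_eq_top_of_card_eq_finrank' (by simp [hY])]
  have := (OrthonormalBasis.mk hf hspan).sum_sq_inner_right ⟨y, hy⟩
  simp only [OrthonormalBasis.coe_mk, f, inner_smul_left, Submodule.coe_inner, Submodule.coe_norm,
    mul_pow, ← Finset.mul_sum] at this
  rw [mul_pow, ← this]
  simp
  field_simp

end IsCliffordFamily

end Clifford

/-! ### Composition with isometries -/

section Isometry

variable {m n : ℕ} {φ : EuclideanSpace ℝ (Fin m) → EuclideanSpace ℝ (Fin n)}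

lemma QuadraticHarmonicMorphisms.apply_smul (hφ : φ ∈ QuadraticHarmonicMorphisms m n) (t : ℝ)
    (x : EuclideanSpace ℝ (Fin m)) : φ (t • x) = t ^ 2 • φ x := by
  obtain ⟨T, -, hT, -⟩ := QuadraticHarmonicMorphisms.exists_operators hφ
  ext a
  simp [hT, inner_smul_left, inner_smul_right]
  ring

lemma IsHarmonicMorphism.comp_isometries (hφ : IsHarmonicMorphism φ)
    (G : EuclideanSpace ℝ (Fin m) ≃ₗᵢ[ℝ] EuclideanSpace ℝ (Fin m))
    (H : EuclideanSpace ℝ (Fin n) ≃ₗᵢ[ℝ] EuclideanSpace ℝ (Fin n)) :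
    IsHarmonicMorphism (H ∘ φ ∘ G) := by
  refine ⟨H.contDiff.comp (hφ.1.comp G.contDiff), fun U f hU hf x hx => ?_⟩
  have h1 : InnerProductSpace.HarmonicOnNhd (f ∘ H) (H ⁻¹' U) := fun y hy =>
    harmonicAt_comp_linearIsometryEquiv H (hf _ hy)
  exact harmonicAt_comp_linearIsometryEquiv G
    (hφ.2 _ _ (hU.preimage H.continuous) h1 (G x) hx)

lemma QuadraticHarmonicMorphisms.comp_isometries (hφ : φ ∈ QuadraticHarmonicMorphisms m n)
    (G : EuclideanSpace ℝ (Fin m) ≃ₗᵢ[ℝ] EuclideanSpace ℝ (Fin m))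
    (H : EuclideanSpace ℝ (Fin n) ≃ₗᵢ[ℝ] EuclideanSpace ℝ (Fin n)) :
    H ∘ φ ∘ G ∈ QuadraticHarmonicMorphisms m n := by
  obtain ⟨T, -, hT, -⟩ := QuadraticHarmonicMorphisms.exists_operators hφ
  refine ⟨hφ.1.comp_isometries G H, fun a => ?_⟩
  -- Component a of the composite is the quadratic form of the combination of the G⁻¹ `T b` G whose
  -- coefficients are row a of the matrix of H.
  let S : EuclideanSpace ℝ (Fin m) →L[ℝ] EuclideanSpace ℝ (Fin m) :=
    ∑ b, H (EuclideanSpace.single b 1) a • (G.symm.toContinuousLinearEquiv :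
      EuclideanSpace ℝ (Fin m) →L[ℝ] EuclideanSpace ℝ (Fin m)) ∘L T b ∘L
        (G.toContinuousLinearEquiv : EuclideanSpace ℝ (Fin m) →L[ℝ] EuclideanSpace ℝ (Fin m))
  obtain ⟨p, hp, hpS⟩ := exists_isHomogeneous_two S
  refine ⟨p, hp, fun x => ?_⟩
  rw [← hpS]
  have h : ∀ y, H y = ∑ b, y b • H (EuclideanSpace.single b 1) := fun y => by
    conv_lhs => rw [← (EuclideanSpace.basisFun (Fin n) ℝ).sum_repr y]
    simp
  simp only [Function.comp_apply]
  rw [h]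
  simp only [S, sum_apply, smul_apply, sum_inner, inner_smul_left, hT]
  simp only [PiLp.smul_apply, WithLp.ofLp_sum, Finset.sum_apply]
  refine Finset.sum_congr rfl fun b _ => ?_
  have : ⟪G.symm (T b (G x)), x⟫ = ⟪T b (G x), G x⟫ := by
    rw [← G.inner_map_map, G.apply_symm_apply]
  simp [this, mul_comm]

end Isometry

/-! ### Restriction to spheres -/

section Sphere

variable {E V : Type*} [NormedAddCommGroup E] [NormedSpace ℝ E]

lemma smul_mem_sphere_of_ne_zero {r : ℝ} (hr : 0 < r) {x : E} (hx : x ≠ 0) :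
    (r / ‖x‖) • x ∈ Metric.sphere (0 : E) r := by
  rw [mem_sphere_zero_iff_norm, norm_smul, Real.norm_of_nonneg (by positivity),
    div_mul_cancel₀ _ (norm_ne_zero_iff.2 hx)]

lemma radialExtension_apply [Zero V] {r : ℝ} (hr : 0 < r) (f : Metric.sphere (0 : E) r → V)
    {x : E} (hx : x ≠ 0) :
    radialExtension r f x = f ⟨(r / ‖x‖) • x, smul_mem_sphere_of_ne_zero hr hx⟩ := by
  rw [radialExtension, dif_pos]

/-- Away from the origin the cone is the preimage of an open set under radial projection. -/
lemma isOpen_coneOver {r : ℝ} (hr : 0 < r) {U : Set (Metric.sphere (0 : E) r)} (hU : IsOpen U) :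
    IsOpen (coneOver U) := by
  obtain ⟨W, hW, rfl⟩ := isOpen_induced_iff.1 hU
  have h : coneOver (((↑) : Metric.sphere (0 : E) r → E) ⁻¹' W) =
      ({0}ᶜ : Set E) ∩ (fun x => (r / ‖x‖) • x) ⁻¹' W := by
    ext x
    constructor
    · rintro ⟨t, ht, y, hy, rfl⟩
      have hyr : ‖(y : E)‖ = r := mem_sphere_zero_iff_norm.1 y.2
      have hy0 : (y : E) ≠ 0 := by rw [← norm_ne_zero_iff, hyr]; exact hr.ne'
      refine ⟨by simp [ht.ne', hy0], ?_⟩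
      have : (r / ‖t • (y : E)‖) • t • (y : E) = y := by
        rw [norm_smul, Real.norm_of_nonneg ht.le, hyr, smul_smul, div_mul_eq_mul_div,
          mul_comm r t, div_self (by positivity), one_smul]
      simpa only [Set.mem_preimage, this] using hy
    · rintro ⟨hx, hxW⟩
      have hx0 : x ≠ 0 := hx
      refine ⟨‖x‖ / r, by positivity, ⟨_, smul_mem_sphere_of_ne_zero hr hx0⟩, hxW, ?_⟩
      rw [smul_smul, div_mul_div_cancel₀ hr.ne', div_self (norm_ne_zero_iff.2 hx0), one_smul]
  rw [h]
  refine ContinuousOn.isOpen_inter_preimage (fun x hx => ?_) isOpen_compl_singleton hW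
  have hx0 : ‖x‖ ≠ 0 := norm_ne_zero_iff.2 hx
  exact ((continuousAt_const.div continuous_norm.continuousAt hx0).smul
    continuousAt_id).continuousWithinAt

/-- A quadratic harmonic morphism that maps spheres about the origin to spheres restricts to a
harmonic morphism between them. -/
theorem isSphereHarmonicMorphism_of_restrict {m n : ℕ}
    {φ : EuclideanSpace ℝ (Fin m) → EuclideanSpace ℝ (Fin n)} (hφ : IsHarmonicMorphism φ)
    (hsmul : ∀ (t : ℝ) x, φ (t • x) = t ^ 2 • φ x) {c : ℝ} (hc : 0 < c)
    (hnorm : ∀ x, ‖φ x‖ = c * ‖x‖ ^ 2)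
    (ψ : Metric.sphere (0 : EuclideanSpace ℝ (Fin m)) 1 →
      Metric.sphere (0 : EuclideanSpace ℝ (Fin n)) c)
    (hψ : ∀ x, (ψ x : EuclideanSpace ℝ (Fin n)) = φ (x : EuclideanSpace ℝ (Fin m))) :
    IsSphereHarmonicMorphism ψ := by
  refine ⟨?_, fun U f hU hf x hx => ?_⟩
  · have h : ContDiffOn ℝ ∞ (fun x : EuclideanSpace ℝ (Fin m) => φ ((1 / ‖x‖) • x)) {0}ᶜ := by
      intro x hx
      have hx0 : ‖x‖ ≠ 0 := norm_ne_zero_iff.2 hx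
      refine (hφ.1.contDiffAt.comp x ?_).contDiffWithinAt
      exact (contDiffAt_const.div (contDiffAt_norm ℝ hx) hx0).smul contDiffAt_id
    refine h.congr fun x hx => ?_
    rw [radialExtension_apply one_pos _ hx, hψ]
  · obtain ⟨t, ht, y, hy, rfl⟩ := hx
    have hy0 : (y : EuclideanSpace ℝ (Fin m)) ≠ 0 := by
      rw [← norm_ne_zero_iff, mem_sphere_zero_iff_norm.1 y.2]; exact one_ne_zero
    have hmem : t • (y : EuclideanSpace ℝ (Fin m)) ∈ φ ⁻¹' coneOver U :=
      ⟨t ^ 2, by positivity, ψ y, hy, by rw [hsmul, hψ]⟩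
    have h := hφ.2 _ _ (isOpen_coneOver hc hU) hf _ hmem
    refine (InnerProductSpace.harmonicAt_congr_nhds ?_).1 h
    have hty : t • (y : EuclideanSpace ℝ (Fin m)) ≠ 0 := smul_ne_zero ht.ne' hy0
    -- Away from 0, pulling back the radial extension of f by φ gives the radial extension of f ∘ ψ:
    -- both normalizations of φ z equal φ z / ‖z‖².
    filter_upwards [isOpen_compl_singleton.mem_nhds hty] with z hz
    have hz0 : z ≠ 0 := hz
    have hφz : φ z ≠ 0 := by
      rw [← norm_ne_zero_iff, hnorm]
      have := norm_pos_iff.2 hz0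
      positivity
    rw [Function.comp_apply, radialExtension_apply hc _ hφz, radialExtension_apply one_pos _ hz0,
      Function.comp_apply]
    congr 1
    ext1
    rw [hψ, hsmul]
    change (c / ‖φ z‖) • φ z = _
    rw [hnorm, ← div_div, div_self hc.ne', div_pow, one_pow]

end Sphere

/-! ### Splitting of Euclidean spaces -/

lemma norm_sq_eq_firstHalf_add_secondHalf {n : ℕ} (z : EuclideanSpace ℝ (Fin (2 * n))) :
    ‖z‖ ^ 2 = ‖firstHalf z‖ ^ 2 + ‖secondHalf z‖ ^ 2 := by
  simp only [EuclideanSpace.real_norm_sq_eq]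
  rw [← (finCongr (two_mul n).symm).sum_comp, Fin.sum_univ_add]
  rfl

/-- The linear isometry given by isometries of two complementary orthogonal projections. -/
lemma exists_isometry_halves {n : ℕ} {X Y : Type*} [NormedAddCommGroup X] [InnerProductSpace ℝ X]
    [NormedAddCommGroup Y] [InnerProductSpace ℝ Y]
    (P : EuclideanSpace ℝ (Fin (2 * n)) →ₗ[ℝ] X) (Q : EuclideanSpace ℝ (Fin (2 * n)) →ₗ[ℝ] Y)
    (hPQ : ∀ z, ‖z‖ ^ 2 = ‖P z‖ ^ 2 + ‖Q z‖ ^ 2)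
    (A : X ≃ₗᵢ[ℝ] EuclideanSpace ℝ (Fin n)) (B : Y ≃ₗᵢ[ℝ] EuclideanSpace ℝ (Fin n)) :
    ∃ G : EuclideanSpace ℝ (Fin (2 * n)) ≃ₗᵢ[ℝ] EuclideanSpace ℝ (Fin (2 * n)),
      ∀ z, firstHalf (G z) = A (P z) ∧ secondHalf (G z) = B (Q z) := by
  let g : EuclideanSpace ℝ (Fin (2 * n)) →ₗ[ℝ] EuclideanSpace ℝ (Fin (2 * n)) :=
    { toFun := fun z => WithLp.toLp 2 fun i =>
        if h : (i : ℕ) < n then A (P z) ⟨i, h⟩ else B (Q z) ⟨i - n, by omega⟩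
      map_add' := fun z w => by
        ext i
        by_cases h : (i : ℕ) < n <;> simp [h]
      map_smul' := fun t z => by
        ext i
        by_cases h : (i : ℕ) < n <;> simp [h] }
  have h1 : ∀ z, firstHalf (g z) = A (P z) := fun z => by
    ext i; simp [firstHalf, g]
  have h2 : ∀ z, secondHalf (g z) = B (Q z) := fun z => by
    ext i; simp [secondHalf, g]
  let G : EuclideanSpace ℝ (Fin (2 * n)) →ₗᵢ[ℝ] EuclideanSpace ℝ (Fin (2 * n)) := ⟨g, fun z => by
    rw [← sq_eq_sq₀ (norm_nonneg _) (norm_nonneg _), norm_sq_eq_firstHalf_add_secondHalf, h1, h2,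
      hPQ, A.norm_map, B.norm_map]⟩
  exact ⟨G.toLinearIsometryEquiv rfl, fun z => ⟨h1 z, h2 z⟩⟩

/-- Extension of an isometry of `ℝⁿ` to `ℝⁿ⁺¹` fixing the first coordinate. -/
lemma exists_isometry_cons {n : ℕ} (C : EuclideanSpace ℝ (Fin n) ≃ₗᵢ[ℝ] EuclideanSpace ℝ (Fin n)) :
    ∃ H : EuclideanSpace ℝ (Fin (n + 1)) ≃ₗᵢ[ℝ] EuclideanSpace ℝ (Fin (n + 1)),
      ∀ v, H v = WithLp.toLp 2 (Fin.cons (v 0) (C (WithLp.toLp 2 fun j => v j.succ)).ofLp) := by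
  let g : EuclideanSpace ℝ (Fin (n + 1)) →ₗ[ℝ] EuclideanSpace ℝ (Fin (n + 1)) :=
    { toFun := fun v => WithLp.toLp 2
        (Fin.cons (v 0) (C (WithLp.toLp 2 fun j => v j.succ)).ofLp)
      map_add' := fun v w => by
        ext i
        refine Fin.cases ?_ (fun j => ?_) i
        · simp
        · have : (WithLp.toLp 2 fun j : Fin n => (v + w) j.succ) =
              WithLp.toLp 2 (fun j => v j.succ) + WithLp.toLp 2 fun j => w j.succ := rfl
          simp only [Fin.cons_succ, PiLp.add_apply]
          rw [← PiLp.add_apply, ← map_add, ← this]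
          rfl
      map_smul' := fun t v => by
        ext i
        refine Fin.cases ?_ (fun j => ?_) i
        · simp
        · have : (WithLp.toLp 2 fun j : Fin n => (t • v) j.succ) =
              t • WithLp.toLp 2 (fun j => v j.succ) := rfl
          simp only [Fin.cons_succ, PiLp.smul_apply, RingHom.id_apply]
          rw [← PiLp.smul_apply, ← map_smul, ← this]
          rfl }
  let H : EuclideanSpace ℝ (Fin (n + 1)) →ₗᵢ[ℝ] EuclideanSpace ℝ (Fin (n + 1)) := ⟨g, fun v => by
    rw [← sq_eq_sq₀ (norm_nonneg _) (norm_nonneg _), EuclideanSpace.real_norm_sq_eq,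
      Fin.sum_univ_succ, EuclideanSpace.real_norm_sq_eq v, Fin.sum_univ_succ]
    simp only [g, LinearMap.coe_mk, AddHom.coe_mk, Fin.cons_zero, Fin.cons_succ]
    rw [← EuclideanSpace.real_norm_sq_eq (C _), C.norm_map, EuclideanSpace.real_norm_sq_eq]⟩
  exact ⟨H.toLinearIsometryEquiv rfl, fun v => rfl⟩

/-! ### Normal form -/

/-- The projection onto the `d`-eigenspace of an operator with square `d ^ 2`. -/
noncomputable def eigenProjection {E : Type*} [AddCommGroup E] [Module ℝ E] (S : E →ₗ[ℝ] E)
    {d : ℝ} (hd : d ≠ 0) (hS : ∀ z, S (S z) = (d * d) • z) :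
    E →ₗ[ℝ] Module.End.eigenspace S d :=
  LinearMap.codRestrict _ ((1 / 2 : ℝ) • (LinearMap.id + d⁻¹ • S)) fun z => by
    rw [Module.End.mem_eigenspace_iff]
    simp only [LinearMap.smul_apply, LinearMap.add_apply, LinearMap.id_apply, map_smul, map_add, hS,
      smul_smul, smul_add]
    rw [show 1 / 2 * d⁻¹ * (d * d) = d * (1 / 2) by field_simp,
      show d * (1 / 2 * d⁻¹) = 1 / 2 by field_simp, add_comm, one_div]

lemma coe_eigenProjection {E : Type*} [AddCommGroup E] [Module ℝ E] (S : E →ₗ[ℝ] E)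
    {d : ℝ} (hd : d ≠ 0) (hS : ∀ z, S (S z) = (d * d) • z) (z : E) :
    (eigenProjection S hd hS z : E) = (1 / 2 : ℝ) • (z + d⁻¹ • S z) := rfl

namespace IsCliffordFamily

variable {E : Type*} [NormedAddCommGroup E] [InnerProductSpace ℝ E] [FiniteDimensional ℝ E]
  {n : ℕ} {T : Fin (n + 1) → E →L[ℝ] E}

omit [FiniteDimensional ℝ E] in
lemma inner_eq_zero_of_mem_eigenspace (h : IsCliffordFamily T) {c : ℝ} (hc : c ≠ 0) {x y : E}
    (hx : x ∈ Module.End.eigenspace (T 0 : E →ₗ[ℝ] E) c)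
    (hy : y ∈ Module.End.eigenspace (T 0 : E →ₗ[ℝ] E) (-c)) : ⟪x, y⟫ = 0 := by
  rw [Module.End.mem_eigenspace_iff, ContinuousLinearMap.coe_coe] at hx hy
  have h1 := h.symm 0 x y
  rw [hx, hy, inner_smul_left, inner_smul_right] at h1
  simp only [conj_trivial] at h1
  have : c * ⟪x, y⟫ = 0 := by linarith
  exact (mul_eq_zero.1 this).resolve_left hc

/-- A nonzero family of `n + 1` operators on a space of dimension `2 n` splits the space into two
`n`-dimensional halves and is described by a norm-multiplicative pairing between them. -/
theorem exists_pairing (h : IsCliffordFamily T) (hE : Module.finrank ℝ E = 2 * n)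
    (hn : 0 < n) (hT0 : T 0 ≠ 0) :
    ∃ (c : ℝ) (X Y : Submodule ℝ E) (P : E →ₗ[ℝ] X) (Q : E →ₗ[ℝ] Y)
      (β : X →ₗ[ℝ] Y →ₗ[ℝ] EuclideanSpace ℝ (Fin n)), 0 < c ∧
      Module.finrank ℝ X = n ∧ Module.finrank ℝ Y = n ∧
      (∀ z, ‖z‖ ^ 2 = ‖P z‖ ^ 2 + ‖Q z‖ ^ 2) ∧ (∀ x y, ‖β x y‖ = ‖x‖ * ‖y‖) ∧
      (∀ z, ⟪T 0 z, z⟫ = c * (‖P z‖ ^ 2 - ‖Q z‖ ^ 2)) ∧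
      ∀ z j, ⟪T (Fin.succ j) z, z⟫ = c * (2 * β (P z) (Q z) j) := by
  obtain ⟨c, hc, hX, hY, hS⟩ := h.exists_eigenspaces hE hn hT0
  let S : E →ₗ[ℝ] E := T 0
  let P := eigenProjection S hc.ne' hS
  let Q := eigenProjection S (neg_ne_zero.2 hc.ne') (fun z => by rw [neg_mul_neg]; exact hS z)
  have hPQ : ∀ z, z = (P z : E) + Q z := fun z => by
    rw [coe_eigenProjection, coe_eigenProjection, inv_neg]; module
  have horth : ∀ z, ⟪(P z : E), (Q z : E)⟫ = 0 := fun z =>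
    h.inner_eq_zero_of_mem_eigenspace hc.ne' (P z).2 (Q z).2
  have hTP : ∀ z, T 0 (P z : E) = c • (P z : E) := fun z =>
    Module.End.mem_eigenspace_iff.1 (P z).2
  have hTQ : ∀ z, T 0 (Q z : E) = (-c) • (Q z : E) := fun z =>
    Module.End.mem_eigenspace_iff.1 (Q z).2
  let β : Module.End.eigenspace S c →ₗ[ℝ] Module.End.eigenspace S (-c) →ₗ[ℝ]
      EuclideanSpace ℝ (Fin n) :=
    LinearMap.mk₂ ℝ (fun x y => WithLp.toLp 2 fun j => c⁻¹ * ⟪T j.succ (x : E), (y : E)⟫)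
      (fun x x' y => by ext j; simp [inner_add_left, mul_add])
      (fun t x y => by ext j; simp [inner_smul_left]; ring)
      (fun x y y' => by ext j; simp [inner_add_right, mul_add])
      (fun t x y => by ext j; simp [inner_smul_right]; ring)
  have hβ : ∀ x y j, β x y j = c⁻¹ * ⟪T j.succ (x : E), (y : E)⟫ := fun x y j => rfl
  refine ⟨c, _, _, P, Q, β, hc, hX, hY, fun z => ?_, fun x y => ?_, fun z => ?_, fun z j => ?_⟩
  · conv_lhs => rw [hPQ z]
    rw [norm_add_sq_real, horth, Submodule.coe_norm, Submodule.coe_norm]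
    ring
  · rw [← sq_eq_sq₀ (norm_nonneg _) (by positivity), EuclideanSpace.real_norm_sq_eq]
    simp only [hβ, mul_pow, ← Finset.mul_sum]
    rw [h.norm_sum_inner hc hY x.2 y.2, Submodule.coe_norm, Submodule.coe_norm]
    field_simp
  · conv_lhs => rw [hPQ z]
    rw [map_add, hTP, hTQ]
    simp only [inner_add_left, inner_add_right, inner_smul_left, horth,
      real_inner_comm (P z : E) (Q z : E), real_inner_self_eq_norm_sq, Submodule.coe_norm]
    simp
    ring
  · conv_lhs => rw [hPQ z]
    have h0 : (0 : Fin (n + 1)) ≠ j.succ := (Fin.succ_ne_zero j).symm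
    -- The diagonal blocks vanish because `T j.succ` exchanges the two eigenspaces; by symmetry the
    -- cross term occurs twice.
    have h1 : ⟪T j.succ (P z : E), (P z : E)⟫ = 0 := by
      rw [real_inner_comm]
      exact h.inner_eq_zero_of_mem_eigenspace hc.ne' (P z).2 (h.apply_mem_eigenspace h0 (P z).2)
    have h2 : ⟪T j.succ (Q z : E), (Q z : E)⟫ = 0 := by
      have := h.apply_mem_eigenspace h0 (Q z).2
      rw [neg_neg] at this
      exact h.inner_eq_zero_of_mem_eigenspace hc.ne' this (Q z).2
    have h3 : ⟪T j.succ (Q z : E), (P z : E)⟫ = ⟪T j.succ (P z : E), (Q z : E)⟫ := by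
      rw [h.symm, real_inner_comm]
    rw [hβ]
    simp only [map_add, inner_add_left, inner_add_right, h1, h2, h3]
    field_simp
    ring

end IsCliffordFamily

/-- A nonzero quadratic harmonic morphism `ℝ²ⁿ → ℝⁿ⁺¹` is a multiple of the Hopf construction
in suitable orthonormal coordinates. -/
theorem QuadraticHarmonicMorphisms.exists_hopf_form {n : ℕ}
    (hn : n = 1 ∨ n = 2 ∨ n = 4 ∨ n = 8)
    {φ : EuclideanSpace ℝ (Fin (2 * n)) → EuclideanSpace ℝ (Fin (n + 1))}
    (hφ : φ ∈ QuadraticHarmonicMorphisms (2 * n) (n + 1)) (hφ0 : φ ≠ 0) :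
    ∃ c : ℝ, 0 < c ∧ (∀ z, ‖φ z‖ = c * ‖z‖ ^ 2) ∧
      ∃ (G : EuclideanSpace ℝ (Fin (2 * n)) ≃ₗᵢ[ℝ] EuclideanSpace ℝ (Fin (2 * n)))
        (H : EuclideanSpace ℝ (Fin (n + 1)) ≃ₗᵢ[ℝ] EuclideanSpace ℝ (Fin (n + 1))),
        ∀ z, H (φ z) = c • hopfConstruction n (G z) := by
  obtain ⟨T, hT, hφT, horth, hnorm⟩ := QuadraticHarmonicMorphisms.exists_operators hφ
  have hC : IsCliffordFamily T := ⟨hT, horth, hnorm⟩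
  have hT0 : T 0 ≠ 0 := by
    rintro h0
    apply hφ0
    ext z a
    have : T a z = 0 := by rw [← norm_eq_zero, hnorm a 0, h0]; simp
    simp [hφT, this]
  obtain ⟨c, X, Y, P, Q, β, hc, hX, hY, hPQ, hβ, h0, hj⟩ :=
    hC.exists_pairing (by simp) (by omega) hT0
  obtain ⟨A, B, C, hABC⟩ := exists_isotopy_standardMul hn hX hY (by simp) β hβ
  obtain ⟨G, hG⟩ := exists_isometry_halves P Q hPQ A B
  obtain ⟨H, hH⟩ := exists_isometry_cons C
  refine ⟨c, hc, fun z => ?_, G, H, fun z => ?_⟩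
  -- With p = ‖P z‖² and q = ‖Q z‖² this is (p - q)² + 4pq = (p + q)².
  · rw [← sq_eq_sq₀ (norm_nonneg _) (by positivity), EuclideanSpace.real_norm_sq_eq,
      Fin.sum_univ_succ]
    simp only [hφT, h0, hj, mul_pow, ← Finset.mul_sum]
    rw [← EuclideanSpace.real_norm_sq_eq, hβ, hPQ]
    ring
  · have htail : (WithLp.toLp 2 fun j : Fin n => φ z j.succ) = (c * 2) • β (P z) (Q z) := by
      ext j
      simp [hφT, hj, mul_assoc]
    rw [hH, htail, map_smul, hABC, hφT, h0]
    ext i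
    refine Fin.cases ?_ (fun j => ?_) i
    · simp [hopfConstruction, hG]
    · simp [hopfConstruction, hG, mul_assoc]

theorem proposition5p6 (n : ℕ) (hn : n = 1 ∨ n = 2 ∨ n = 4 ∨ n = 8)
    (φ : EuclideanSpace ℝ (Fin (2 * n)) → EuclideanSpace ℝ (Fin (n + 1)))
    (hφ : φ ∈ QuadraticHarmonicMorphisms (2 * n) (n + 1)) :
    ∃ c : ℝ, 0 ≤ c ∧ BiEquivalent φ (c • hopfConstruction n) ∧
      (φ ≠ 0 → 0 < c ∧
        ∃ ψ : Metric.sphere (0 : EuclideanSpace ℝ (Fin (2 * n))) 1 →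
            Metric.sphere (0 : EuclideanSpace ℝ (Fin (n + 1))) c,
          (∀ x, (ψ x : EuclideanSpace ℝ (Fin (n + 1))) =
            φ (x : EuclideanSpace ℝ (Fin (2 * n)))) ∧
          IsSphereHarmonicMorphism ψ) := by
  by_cases hφ0 : φ = 0
  · subst hφ0
    refine ⟨0, le_rfl, ⟨hφ, by rw [zero_smul]; exact hφ, LinearIsometryEquiv.refl ℝ _,
      LinearIsometryEquiv.refl ℝ _, ?_⟩, fun h => absurd rfl h⟩
    ext z
    simp
  obtain ⟨c, hc, hnorm, G, H, hGH⟩ := QuadraticHarmonicMorphisms.exists_hopf_form hn hφ hφ0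
  -- The scaled Hopf map is φ in other orthonormal coordinates, so it inherits being a quadratic
  -- harmonic morphism without any computation with the multiplication.
  have hhopf : c • hopfConstruction n = H ∘ φ ∘ G.symm := by
    funext z
    simp [hGH]
  refine ⟨c, hc.le, ⟨hφ, ?_, G, H, ?_⟩, fun _ => ⟨hc, fun x => ⟨φ x, ?_⟩, fun x => rfl, ?_⟩⟩
  · rw [hhopf]
    exact QuadraticHarmonicMorphisms.comp_isometries hφ G.symm H
  · rw [hhopf]
    funext z
    simp
  · rw [mem_sphere_zero_iff_norm, hnorm, mem_sphere_zero_iff_norm.1 x.2]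
    ring
  · exact isSphereHarmonicMorphism_of_restrict hφ.1
      (QuadraticHarmonicMorphisms.apply_smul hφ) hc hnorm _ fun x => rfl
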